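/- Let $G$ be the Heisenberg group of real matrices $\begin{pmatrix}1&a&c\\0&1&b\\0&0&1\end{pmatrix}$, let $H\subset G$ be the discrete subgroup of matrices with integer entries, and let $M=H\backslash G=\{Hg \mid g\in G\}$ be the Heisenberg nil-manifold, with projection $\pi:G\to M$. In the coordinates $(x,y,z)$ on $G$ given by $a=x$, $b=y$, $c=z+\frac{xy}{2}$, consider the left-invariant vector fields $X_1=\frac{\partial}{\partial x}-\frac y2\frac{\partial}{\partial z}$ and $X_2=\frac{\partial}{\partial y}+\frac x2\frac{\partial}{\partial z}$, and equip $M$ with the sub-Riemannian structure for which $\pi_*X_1,\pi_*X_2$ is an orthonormal frame. A horizontal curve is a Lipschitz curve $q$ in $M$ with $\dot q=u_1\,\pi_*X_1+u_2\,\pi_*X_2$ almost everywhere; its length is $\int\sqrt{u_1^2+u_2^2}\,dt$; and $d'(q_0,q_1)$ is the infimum of the lengths of the horizontal curves from $q_0$ to $q_1$. A length minimizer is a horizontal curve whose length equals the distance $d'$ between its endpoints, and a geodesic is a horizontal curve whose sufficiently short arcs are length minimizers. For $q_0\in M$ put $B'_t=\{q\in M\mid d'(q_0,q)\le t\}$ and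 $\bar t=\inf\{t>0\mid B'_t=M\}$. Let $$t_*=\frac12\sqrt{\frac12\left(1+\sqrt{1+1024\pi^2}\right)}\approx 3.56 .$$ Then for every $q_0\in M$ we have $B'_{t_*}=M$, and hence $\bar t\le t_*$. Moreover, every geodesic $q(\cdot)$ in $M$ that is parametrized by arclength and starts at $q(0)=q_0$ has cut time $\sup\{\tau>0\mid q|_{[0,\tau]}\text{ is a length minimizer}\}\le t_*$, and the diameter $\sup\{d'(q_1,q_2)\mid q_1,q_2\in M\}$ of $M$ is at most $2t_*$. -/

import Mathlib

open MeasureTheory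
open scoped ENNReal

noncomputable section

/-- The Heisenberg group `G`: the element `⟨a, b, c⟩` stands for the unipotent matrix
`!![1, a, c; 0, 1, b; 0, 0, 1]`. -/
@[ext]
structure Heisenberg where
  a : ℝ
  b : ℝ
  c : ℝ

namespace Heisenberg

/-- The matrix represented by an element of `G`. -/
def toMatrix (g : Heisenberg) : Matrix (Fin 3) (Fin 3) ℝ :=
  !![1, g.a, g.c; 0, 1, g.b; 0, 0, 1]

instance : Mul Heisenberg := ⟨fun g h => ⟨g.a + h.a, g.b + h.b, g.c + h.c + g.a * h.b⟩⟩

instance : One Heisenberg := ⟨⟨0, 0, 0⟩⟩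

instance : Inv Heisenberg := ⟨fun g => ⟨-g.a, -g.b, -g.c + g.a * g.b⟩⟩

@[simp] theorem mul_a (g h : Heisenberg) : (g * h).a = g.a + h.a := rfl
@[simp] theorem mul_b (g h : Heisenberg) : (g * h).b = g.b + h.b := rfl
@[simp] theorem mul_c (g h : Heisenberg) : (g * h).c = g.c + h.c + g.a * h.b := rfl
@[simp] theorem one_a : (1 : Heisenberg).a = 0 := rfl
@[simp] theorem one_b : (1 : Heisenberg).b = 0 := rfl
@[simp] theorem one_c : (1 : Heisenberg).c = 0 := rfl
@[simp] theorem inv_a (g : Heisenberg) : g⁻¹.a = -g.a := rfl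
@[simp] theorem inv_b (g : Heisenberg) : g⁻¹.b = -g.b := rfl
@[simp] theorem inv_c (g : Heisenberg) : g⁻¹.c = -g.c + g.a * g.b := rfl

instance : Group Heisenberg :=
  Group.ofLeftAxioms
    (fun f g h => by ext <;> simp <;> ring)
    (fun g => by ext <;> simp)
    (fun g => by ext <;> simp)

/-- The group law of `G` is matrix multiplication. -/
theorem toMatrix_mul (g h : Heisenberg) : (g * h).toMatrix = g.toMatrix * h.toMatrix := by
  ext i j
  fin_cases i <;> fin_cases j <;> simp [toMatrix, Matrix.mul_apply, Fin.sum_univ_three] <;> ring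

theorem toMatrix_one : (1 : Heisenberg).toMatrix = 1 := by
  ext i j
  fin_cases i <;> fin_cases j <;> simp [toMatrix]

/-- The global coordinates `(x, y, z)` on `G`, with `a = x`, `b = y`, `c = z + x y / 2`. -/
def coord (g : Heisenberg) : ℝ × ℝ × ℝ := (g.a, g.b, g.c - g.a * g.b / 2)

/-- The left-invariant vector field `X₁ = ∂/∂x - (y/2) ∂/∂z`, in the coordinates `(x, y, z)`. -/
def X₁ (g : Heisenberg) : ℝ × ℝ × ℝ := (1, 0, -(g.b / 2))

/-- The left-invariant vector field `X₂ = ∂/∂y + (x/2) ∂/∂z`, in the coordinates `(x, y, z)`. -/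
def X₂ (g : Heisenberg) : ℝ × ℝ × ℝ := (0, 1, g.a / 2)

/-- On the set `I` of times, `g` is a Lipschitz horizontal curve in `G` with control `u`:
`g' = u₁ X₁(g) + u₂ X₂(g)` almost everywhere on `I`. -/
def IsTrajectoryOn (g : ℝ → Heisenberg) (u : ℝ → ℝ × ℝ) (I : Set ℝ) : Prop :=
  (∃ K, LipschitzOnWith K (fun t => coord (g t)) I) ∧
    ∀ᵐ t : ℝ, t ∈ I →
      HasDerivAt (fun s => coord (g s)) ((u t).1 • X₁ (g t) + (u t).2 • X₂ (g t)) t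

/-- The discrete subgroup `H` of the matrices with integer entries. -/
def lattice : Subgroup Heisenberg where
  carrier := {g | ∃ m n k : ℤ, g = ⟨m, n, k⟩}
  mul_mem' := by
    rintro _ _ ⟨m, n, k, rfl⟩ ⟨m', n', k', rfl⟩
    exact ⟨m + m', n + n', k + k' + m * n', by ext <;> simp⟩
  one_mem' := ⟨0, 0, 0, by ext <;> simp⟩
  inv_mem' := by
    rintro _ ⟨m, n, k, rfl⟩
    exact ⟨-m, -n, -k + m * n, by ext <;> simp⟩

end Heisenberg

open Heisenberg

/-- The Heisenberg nil-manifold `M = H \ G`, the space of right cosets `H g`. -/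
abbrev NilManifold : Type := Quotient (QuotientGroup.rightRel Heisenberg.lattice)

namespace NilManifold

/-- The canonical projection `π : G → M`, `g ↦ H g`. -/
def proj (g : Heisenberg) : NilManifold := Quotient.mk _ g

/-- `q`, restricted to the compact interval `[α, β]`, is a Lipschitz horizontal curve in `M` with
control `u`, that is, `q' = u₁ X₁'(q) + u₂ X₂'(q)` almost everywhere, where `Xᵢ' = π_* Xᵢ`.
The local sections of the covering `π` are the charts of `M`, and the fields `Xᵢ` are invariant
under left translations, so the condition is read off, near each time `s`, on a local lift of the
curve to `G`. The control is determined by `q` up to equality almost everywhere. -/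
def IsTrajectory (q : ℝ → NilManifold) (u : ℝ → ℝ × ℝ) (α β : ℝ) : Prop :=
  ∀ s ∈ Set.Icc α β, ∃ ε > 0, ∃ g : ℝ → Heisenberg,
    (∀ t ∈ Set.Ioo (s - ε) (s + ε) ∩ Set.Icc α β, proj (g t) = q t) ∧
      IsTrajectoryOn g u (Set.Ioo (s - ε) (s + ε) ∩ Set.Icc α β)

/-- The sub-Riemannian length `∫ √(u₁² + u₂²) dt` over `[α, β]` of a horizontal curve with
control `u` (the frame `X₁', X₂'` is orthonormal). -/
def srLength (u : ℝ → ℝ × ℝ) (α β : ℝ) : ℝ≥0∞ :=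
  ∫⁻ t in Set.Icc α β, ENNReal.ofReal (Real.sqrt ((u t).1 ^ 2 + (u t).2 ^ 2))

/-- The sub-Riemannian distance on `M`: the infimum of the lengths of the horizontal curves
from `q₀` to `q₁`, equal to `∞` if there is none. -/
def srDist (q₀ q₁ : NilManifold) : ℝ≥0∞ :=
  sInf {ℓ | ∃ (T : ℝ) (q : ℝ → NilManifold) (u : ℝ → ℝ × ℝ), 0 < T ∧ IsTrajectory q u 0 T ∧
    q 0 = q₀ ∧ q T = q₁ ∧ ℓ = srLength u 0 T}

/-- The closed sub-Riemannian ball in `M` of radius `t` centred at `q₀`. -/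
def srBall (q₀ : NilManifold) (t : ℝ) : Set NilManifold :=
  {q | srDist q₀ q ≤ ENNReal.ofReal t}

/-- `inf {t > 0 | the ball of radius t centred at q₀ is M}`, equal to `∞` if there is no such `t`. -/
def coveringRadius (q₀ : NilManifold) : ℝ≥0∞ :=
  sInf {r | ∃ t : ℝ, 0 < t ∧ srBall q₀ t = Set.univ ∧ r = ENNReal.ofReal t}

/-- The sub-Riemannian diameter of `M`. -/
def srDiam : ℝ≥0∞ := ⨆ (q₁ : NilManifold) (q₂ : NilManifold), srDist q₁ q₂

/-- The restriction to `[α, β]` of the curve `q` with control `u` is a length minimizer: it is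
horizontal and its length equals the distance between its end points. -/
def IsMinimizer (q : ℝ → NilManifold) (u : ℝ → ℝ × ℝ) (α β : ℝ) : Prop :=
  IsTrajectory q u α β ∧ srLength u α β = srDist (q α) (q β)

/-- On the interval `J`, the curve `q` with control `u` is a sub-Riemannian geodesic parametrized
by arclength: it is horizontal of unit speed, and its sufficiently short arcs are length
minimizers. -/
def IsGeodesic (q : ℝ → NilManifold) (u : ℝ → ℝ × ℝ) (J : Set ℝ) : Prop :=
  (∀ α β, α ≤ β → Set.Icc α β ⊆ J → IsTrajectory q u α β) ∧
    (∀ᵐ t : ℝ, t ∈ J → (u t).1 ^ 2 + (u t).2 ^ 2 = 1) ∧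
      ∀ s ∈ J, ∃ ε > 0, ∀ α ∈ J, ∀ β ∈ J, s - ε < α → α < β → β < s + ε → IsMinimizer q u α β

/-- The cut time `sup {τ > 0 | q restricted to [0, τ] is a length minimizer}` of a curve `q` with
control `u` defined on the interval `J`. -/
def cutTime (q : ℝ → NilManifold) (u : ℝ → ℝ × ℝ) (J : Set ℝ) : ℝ≥0∞ :=
  sSup {r | ∃ τ : ℝ, 0 < τ ∧ Set.Icc 0 τ ⊆ J ∧ IsMinimizer q u 0 τ ∧ r = ENNReal.ofReal τ}

end NilManifold

/-- The number `t* = ½ √(½ (1 + √(1 + 1024 π²)))`. -/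
def tStar : ℝ := 1 / 2 * Real.sqrt (1 / 2 * (1 + Real.sqrt (1 + 1024 * Real.pi ^ 2)))

end

/-! Any two points of `M` are less than `tStar` apart, and every claim follows from this. In `G`,
the displacement `(x, y, z)` costs at most `√(x² + y²) + √(4π|z|)`: a segment of length `√(x² + y²)`
plus a circle enclosing area `|z|` (`srDist_mul_ofCoord_le`). Modulo the lattice, the displacement
can be taken in the cube of half-side `1/2` (`exists_lift_mem_cube`). The cost is then at most
`√(1/2) + √(2π) < 3.22`, while `tStar > 3.555`. A unit-speed minimizer on `[0, τ]` has length `τ`,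
which bounds its cut time. -/

open Real in
theorem abs_tStar_sub_lt : |tStar - 3.56| < 0.005 := by
  have hlo : (3.14 : ℝ) < π := pi_gt_d2
  have hhi : π < (3.1416 : ℝ) := pi_lt_d4
  have h1 : (100.2 : ℝ) < √(1 + 1024 * π ^ 2) := by
    apply Real.lt_sqrt_of_sq_lt
    nlinarith
  have h2 : √(1 + 1024 * π ^ 2) < 100.6 := by
    rw [Real.sqrt_lt' (by norm_num)]
    nlinarith
  have h3 : (7.11 : ℝ) < √(1 / 2 * (1 + √(1 + 1024 * π ^ 2))) := by
    apply Real.lt_sqrt_of_sq_lt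
    linarith
  have h4 : √(1 / 2 * (1 + √(1 + 1024 * π ^ 2))) < 7.13 := by
    rw [Real.sqrt_lt' (by norm_num)]
    linarith
  rw [tStar, abs_lt]
  constructor <;> linarith

theorem lt_tStar : 3.555 < tStar := by
  have := (abs_lt.1 abs_tStar_sub_lt).1
  linarith

/-! ### Horizontal lifts of plane curves -/

namespace Heisenberg

/-- The element with coordinates `(x, y, z)`. -/
noncomputable def ofCoord (x y z : ℝ) : Heisenberg := ⟨x, y, z + x * y / 2⟩

theorem ofCoord_coord (g : Heisenberg) :
    ofCoord (coord g).1 (coord g).2.1 (coord g).2.2 = g := by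
  ext <;> simp [ofCoord, coord]

/-- Left translation in the coordinates `(x, y, z)`. -/
theorem coord_mul_ofCoord (g : Heisenberg) (x y z : ℝ) :
    coord (g * ofCoord x y z) =
      (g.a + x, g.b + y, g.c - g.a * g.b / 2 + z + (g.a * y - g.b * x) / 2) := by
  simp only [coord, ofCoord, mul_a, mul_b, mul_c, Prod.mk.injEq, true_and]
  ring

/-- A `C¹` plane curve `(x, y)`, lifted to `G` by its signed area `z` and translated by `g`,
is a trajectory. -/
theorem isTrajectoryOn_mul_ofCoord (g : Heisenberg) {x y z x' y' : ℝ → ℝ}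
    (hx : ∀ t, HasDerivAt x (x' t) t) (hy : ∀ t, HasDerivAt y (y' t) t)
    (hz : ∀ t, HasDerivAt z ((x t * y' t - y t * x' t) / 2) t)
    (hx' : Continuous x') (hy' : Continuous y') {I : Set ℝ} {α β : ℝ} (hI : I ⊆ Set.Icc α β) :
    IsTrajectoryOn (fun t => g * ofCoord (x t) (y t) (z t)) (fun t => (x' t, y' t)) I := by
  have hd : ∀ t, HasDerivAt (fun s => coord (g * ofCoord (x s) (y s) (z s)))
      (x' t • X₁ (g * ofCoord (x t) (y t) (z t)) +
        y' t • X₂ (g * ofCoord (x t) (y t) (z t))) t := by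
    intro t
    simp only [coord_mul_ofCoord]
    have h1 := (hx t).const_add g.a
    have h2 := (hy t).const_add g.b
    have h3 := ((hz t).const_add (g.c - g.a * g.b / 2)).add
      ((((hy t).const_mul g.a).sub ((hx t).const_mul g.b)).div_const 2)
    refine (h1.prodMk (h2.prodMk h3)).congr_deriv ?_
    simp only [X₁, X₂, ofCoord, mul_a, mul_b, Prod.smul_mk, Prod.mk_add_mk, smul_eq_mul,
      Prod.mk.injEq]
    refine ⟨by ring, by ring, by ring⟩
  refine ⟨?_, Filter.Eventually.of_forall fun t _ => hd t⟩
  have hcx : Continuous x := continuous_iff_continuousAt.2 fun t => (hx t).continuousAt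
  have hcy : Continuous y := continuous_iff_continuousAt.2 fun t => (hy t).continuousAt
  have hc : Continuous fun t => x' t • X₁ (g * ofCoord (x t) (y t) (z t)) +
      y' t • X₂ (g * ofCoord (x t) (y t) (z t)) := by
    simp only [X₁, X₂, ofCoord, mul_a, mul_b]
    fun_prop
  -- `I` need be neither compact nor convex, so the velocity is bounded on the enclosing interval.
  obtain ⟨C, hC⟩ := isCompact_Icc.exists_bound_of_continuousOn (s := Set.Icc α β) hc.continuousOn
  refine ⟨C.toNNReal, LipschitzOnWith.mono ?_ hI⟩
  refine (convex_Icc α β).lipschitzOnWith_of_nnnorm_hasDerivWithin_le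
    (fun t _ => (hd t).hasDerivWithinAt) fun t ht => ?_
  rw [← NNReal.coe_le_coe, coe_nnnorm]
  exact (hC t ht).trans (Real.le_coe_toNNReal C)

end Heisenberg

/-! ### Distance bounds on the nil-manifold -/

namespace NilManifold

open Heisenberg

theorem srDist_proj_le (g : Heisenberg) {x y z x' y' : ℝ → ℝ} {ℓ : ℝ}
    (hx : ∀ t, HasDerivAt x (x' t) t) (hy : ∀ t, HasDerivAt y (y' t) t)
    (hz : ∀ t, HasDerivAt z ((x t * y' t - y t * x' t) / 2) t)
    (hx' : Continuous x') (hy' : Continuous y') (hx0 : x 0 = 0) (hy0 : y 0 = 0) (hz0 : z 0 = 0)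
    (hℓ : ∀ t, √(x' t ^ 2 + y' t ^ 2) ≤ ℓ) :
    srDist (proj g) (proj (g * ofCoord (x 1) (y 1) (z 1))) ≤ ENNReal.ofReal ℓ := by
  have h1 : ofCoord 0 0 0 = 1 := by ext <;> simp [ofCoord]
  calc srDist (proj g) (proj (g * ofCoord (x 1) (y 1) (z 1)))
      ≤ srLength (fun t => (x' t, y' t)) 0 1 := by
        apply sInf_le
        refine ⟨1, fun t => proj (g * ofCoord (x t) (y t) (z t)), fun t => (x' t, y' t), one_pos,
          fun s _ => ⟨1, one_pos, fun t => g * ofCoord (x t) (y t) (z t), fun _ _ => rfl,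
            isTrajectoryOn_mul_ofCoord g hx hy hz hx' hy' Set.inter_subset_right⟩, ?_, rfl, rfl⟩
        simp [hx0, hy0, hz0, h1]
    _ ≤ ∫⁻ _ in Set.Icc (0 : ℝ) 1, ENNReal.ofReal ℓ :=
        lintegral_mono fun t => ENNReal.ofReal_le_ofReal (hℓ t)
    _ = ENNReal.ofReal ℓ := by simp

/-- Superposing a segment and a circle that starts in the direction of the segment joins `g` to
its translate with coordinates `(ρ cos θ, ρ sin θ, σ π r²)`. -/
theorem srDist_segment_circle_le (g : Heisenberg) {ρ r θ σ : ℝ} (hρ : 0 ≤ ρ) (hr : 0 ≤ r)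
    (hσ : σ ^ 2 = 1) :
    srDist (proj g)
      (proj (g * ofCoord (ρ * Real.cos θ) (ρ * Real.sin θ) (σ * (Real.pi * r ^ 2)))) ≤
        ENNReal.ofReal (ρ + 2 * Real.pi * r) := by
  set ω : ℝ := 2 * Real.pi with hω
  have hω0 : 0 < ω := by positivity
  set c := Real.cos θ
  set s := Real.sin θ
  have hcs : s ^ 2 + c ^ 2 = 1 := Real.sin_sq_add_cos_sq θ
  let C : ℝ → ℝ := fun t => Real.cos (ω * t)
  let S : ℝ → ℝ := fun t => Real.sin (ω * t)
  have hCS : ∀ t, S t ^ 2 + C t ^ 2 = 1 := fun t => Real.sin_sq_add_cos_sq _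
  have hlin : ∀ t, HasDerivAt (fun t : ℝ => ω * t) ω t := fun t => by
    simpa using (hasDerivAt_id t).const_mul ω
  have hC : ∀ t, HasDerivAt C (-(ω * S t)) t := fun t => by
    refine (hlin t).cos.congr_deriv ?_
    simp only [S]
    ring
  have hS : ∀ t, HasDerivAt S (ω * C t) t := fun t => by
    refine (hlin t).sin.congr_deriv ?_
    simp only [C]
    ring
  have hCc : Continuous C := by fun_prop
  have hSc : Continuous S := by fun_prop
  -- `A` runs along the segment and `B` across it. At time `0` the circle's velocity is orthogonal
  -- to the segment; this makes the mixed term of the area vanish at `t = 1`.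
  let A : ℝ → ℝ := fun t => ρ * t + r * (C t - 1)
  let B : ℝ → ℝ := fun t => σ * r * S t
  let A' : ℝ → ℝ := fun t => ρ - r * (ω * S t)
  let B' : ℝ → ℝ := fun t => σ * r * (ω * C t)
  have hA : ∀ t, HasDerivAt A (A' t) t := fun t => by
    refine (((hasDerivAt_id t).const_mul ρ).add
      (((hC t).sub_const 1).const_mul r)).congr_deriv ?_
    simp only [A']
    ring
  have hB : ∀ t, HasDerivAt B (B' t) t := fun t => (hS t).const_mul (σ * r)
  have hA'c : Continuous A' := by fun_prop
  have hB'c : Continuous B' := by fun_prop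
  -- Signed area swept by `(A, B)`: the `ρ * r` term is the segment-circle interaction, the `r ^ 2`
  -- term is the circle alone.
  let z : ℝ → ℝ := fun t =>
    σ / 2 * (ρ * r * (t * S t + 2 / ω * (C t - 1)) + r ^ 2 * (ω * t - S t))
  have hz : ∀ t, HasDerivAt z ((A t * B' t - B t * A' t) / 2) t := fun t => by
    have h1 := (((hasDerivAt_id t).mul (hS t)).add
      (((hC t).sub_const 1).const_mul (2 / ω))).const_mul (ρ * r)
    have h2 := ((hlin t).sub (hS t)).const_mul (r ^ 2)
    refine ((h1.add h2).const_mul (σ / 2)).congr_deriv ?_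
    simp only [A, B, A', B', id]
    field_simp
    linear_combination -σ * r ^ 2 * ω * hCS t
  have hC1 : C 1 = 1 := by simp [C, hω]
  have hS1 : S 1 = 0 := by simp [S, hω]
  have hC0 : C 0 = 1 := by simp [C]
  have hS0 : S 0 = 0 := by simp [S]
  have key := srDist_proj_le g (x := fun t => A t * c - B t * s) (y := fun t => A t * s + B t * c)
    (z := z) (x' := fun t => A' t * c - B' t * s) (y' := fun t => A' t * s + B' t * c)
    (ℓ := ρ + ω * r)
    (fun t => ((hA t).mul_const c).sub ((hB t).mul_const s))
    (fun t => ((hA t).mul_const s).add ((hB t).mul_const c))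
    -- Rotation by `θ` preserves the area form.
    (fun t => by
      refine (hz t).congr_deriv ?_
      linear_combination -(A t * B' t - B t * A' t) / 2 * hcs)
    (by fun_prop) (by fun_prop) (by simp [A, B, hC0, hS0]) (by simp [A, B, hC0, hS0])
    (by simp [z, hC0, hS0])
    (fun t => by
      apply Real.sqrt_le_iff.2 ⟨by positivity, ?_⟩
      have h1 : (A' t * c - B' t * s) ^ 2 + (A' t * s + B' t * c) ^ 2 =
          ρ ^ 2 + (ω * r) ^ 2 - 2 * ρ * (ω * r) * S t := by
        simp only [A', B']
        linear_combination ((ρ - r * (ω * S t)) ^ 2 + (σ * r * (ω * C t)) ^ 2) * hcs +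
          (r * ω * C t) ^ 2 * hσ + (r * ω) ^ 2 * hCS t
      have h2 : -1 ≤ S t := Real.neg_one_le_sin _
      have h3 : 0 ≤ ρ * (ω * r) := by positivity
      nlinarith)
  have e1 : A 1 * c - B 1 * s = ρ * c := by simp [A, B, hC1, hS1]
  have e2 : A 1 * s + B 1 * c = ρ * s := by simp [A, B, hC1, hS1]
  have e3 : z 1 = σ * (Real.pi * r ^ 2) := by simp [z, hC1, hS1, hω]; ring
  simpa only [e1, e2, e3] using key

/-- Polar coordinates give the segment; the circle has `π r² = |z|` and is oriented by the sign `σ`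
of `z`. -/
theorem srDist_mul_ofCoord_le (g : Heisenberg) (x y z : ℝ) :
    srDist (proj g) (proj (g * ofCoord x y z)) ≤
      ENNReal.ofReal (√(x ^ 2 + y ^ 2) + √(4 * Real.pi * |z|)) := by
  obtain ⟨σ, hσ, hz⟩ : ∃ σ : ℝ, σ ^ 2 = 1 ∧ σ * |z| = z := by
    rcases abs_cases z with ⟨h, -⟩ | ⟨h, -⟩
    · exact ⟨1, by norm_num, by rw [h, one_mul]⟩
    · exact ⟨-1, by norm_num, by rw [h]; ring⟩
  have hπ := Real.pi_pos
  have key := srDist_segment_circle_le g (θ := Complex.arg ⟨x, y⟩) (norm_nonneg (⟨x, y⟩ : ℂ))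
    (Real.sqrt_nonneg (|z| / Real.pi)) hσ
  rw [Complex.norm_mul_cos_arg, Complex.norm_mul_sin_arg, Real.sq_sqrt (by positivity),
    mul_div_cancel₀ _ hπ.ne', hz] at key
  have h1 : ‖(⟨x, y⟩ : ℂ)‖ = √(x ^ 2 + y ^ 2) := by
    rw [Complex.norm_eq_sqrt_sq_add_sq]
  have h2 : 2 * Real.pi * √(|z| / Real.pi) = √(4 * Real.pi * |z|) := by
    rw [eq_comm, Real.sqrt_eq_iff_mul_self_eq (by positivity) (by positivity),
      mul_mul_mul_comm, Real.mul_self_sqrt (by positivity)]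
    field_simp
    ring
  rwa [h1, h2] at key

/-- Every point of `M` has a lift in the unit cube, in coordinates centred at a given `g`. -/
theorem exists_lift_mem_cube (g : Heisenberg) (q : NilManifold) :
    ∃ x y z : ℝ, |x| ≤ 1 / 2 ∧ |y| ≤ 1 / 2 ∧ |z| ≤ 1 / 2 ∧ proj (g * ofCoord x y z) = q := by
  obtain ⟨h, rfl⟩ : ∃ h, proj h = q := Quotient.exists_rep q
  let γ (k : ℤ) : Heisenberg := ⟨-round (h.a - g.a), -round (h.b - g.b), k⟩
  -- Rounding the first two entries also changes the third coordinate, so the central integer is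
  -- chosen last; it shifts `z` alone.
  let z₀ : ℝ := (coord (g⁻¹ * (γ 0 * h))).2.2
  let p : Heisenberg := g⁻¹ * (γ (-round z₀) * h)
  have hp : (coord p).2.2 = z₀ - round z₀ := by
    simp only [p, z₀, γ, coord, mul_a, mul_b, mul_c, inv_a, inv_b, inv_c]
    push_cast
    ring
  refine ⟨(coord p).1, (coord p).2.1, (coord p).2.2, ?_, ?_, ?_, ?_⟩
  · have hp' : (coord p).1 = h.a - g.a - round (h.a - g.a) := by
      simp only [p, γ, coord, mul_a, inv_a]
      ring
    rw [hp']
    exact abs_sub_round _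
  · have hp' : (coord p).2.1 = h.b - g.b - round (h.b - g.b) := by
      simp only [p, γ, coord, mul_b, inv_b]
      ring
    rw [hp']
    exact abs_sub_round _
  · rw [hp]
    exact abs_sub_round z₀
  · rw [ofCoord_coord, mul_inv_cancel_left]
    refine Quotient.sound (QuotientGroup.rightRel_apply.2 ?_)
    rw [mul_inv_rev, mul_inv_cancel_left]
    exact inv_mem ⟨-round (h.a - g.a), -round (h.b - g.b), -round z₀, by simp [γ]⟩

theorem srDist_le_tStar (q₀ q₁ : NilManifold) : srDist q₀ q₁ ≤ ENNReal.ofReal tStar := by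
  obtain ⟨g, rfl⟩ : ∃ g, proj g = q₀ := Quotient.exists_rep q₀
  obtain ⟨x, y, z, hx, hy, hz, rfl⟩ := exists_lift_mem_cube g q₁
  refine (srDist_mul_ofCoord_le g x y z).trans (ENNReal.ofReal_le_ofReal ?_)
  -- Rational bounds for `√(1/2)` here and `√(2π)` below; their sum is `3.35`.
  have h1 : √(x ^ 2 + y ^ 2) ≤ 0.75 := by
    refine Real.sqrt_le_iff.2 ⟨by norm_num, ?_⟩
    have := sq_le_sq' (abs_le.1 hx).1 (abs_le.1 hx).2
    have := sq_le_sq' (abs_le.1 hy).1 (abs_le.1 hy).2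
    linarith
  have h2 : √(4 * Real.pi * |z|) ≤ 2.6 := by
    refine Real.sqrt_le_iff.2 ⟨by norm_num, ?_⟩
    nlinarith [Real.pi_lt_d2, Real.pi_pos, abs_nonneg z]
  linarith [lt_tStar]

theorem srLength_of_unit_speed {u : ℝ → ℝ × ℝ} {J : Set ℝ} {τ : ℝ} (hJ : Set.Icc 0 τ ⊆ J)
    (hu : ∀ᵐ t : ℝ, t ∈ J → (u t).1 ^ 2 + (u t).2 ^ 2 = 1) :
    srLength u 0 τ = ENNReal.ofReal τ := by
  calc srLength u 0 τ = ∫⁻ _ in Set.Icc 0 τ, 1 := by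
        refine setLIntegral_congr_fun_ae measurableSet_Icc ?_
        filter_upwards [hu] with t ht htI
        simp [ht (hJ htI)]
    _ = ENNReal.ofReal τ := by simp

end NilManifold

theorem mainTheorem8 :
    (∀ q₀ : NilManifold,
      NilManifold.srBall q₀ tStar = Set.univ ∧
      NilManifold.coveringRadius q₀ ≤ ENNReal.ofReal tStar ∧
      ∀ (J : Set ℝ) (q : ℝ → NilManifold) (u : ℝ → ℝ × ℝ),
        J.OrdConnected → J ⊆ Set.Ici 0 → 0 ∈ J → NilManifold.IsGeodesic q u J → q 0 = q₀ →
          NilManifold.cutTime q u J ≤ ENNReal.ofReal tStar) ∧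
    NilManifold.srDiam ≤ ENNReal.ofReal (2 * tStar) ∧
    |tStar - 3.56| < 0.005 := by
  have hpos : 0 < tStar := by linarith [lt_tStar]
  have hball : ∀ q₀, NilManifold.srBall q₀ tStar = Set.univ := fun q₀ =>
    Set.eq_univ_of_forall (NilManifold.srDist_le_tStar q₀)
  refine ⟨fun q₀ => ⟨hball q₀, sInf_le ⟨tStar, hpos, hball q₀, rfl⟩, ?_⟩, ?_, abs_tStar_sub_lt⟩
  · rintro J q u - - - ⟨-, hspeed, -⟩ -
    refine sSup_le ?_
    rintro _ ⟨τ, -, hτJ, ⟨-, hmin⟩, rfl⟩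
    rw [← NilManifold.srLength_of_unit_speed hτJ hspeed, hmin]
    exact NilManifold.srDist_le_tStar _ _
  -- The uniform bound already gives diameter at most `tStar`; the factor `2` is slack.
  · refine iSup₂_le fun q₁ q₂ => (NilManifold.srDist_le_tStar q₁ q₂).trans ?_
    exact ENNReal.ofReal_le_ofReal (by linarith)
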